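/- **Setting.** A weighted graph $(X,\omega,\mu)$ consists of a countably infinite set $X$, a function $\mu:X\to(0,\infty)$ and a symmetric function $\omega:X\times X\to[0,\infty)$ with $\omega(x,x)=0$ and $\sum_{y}\omega(x,y)<\infty$ for all $x$; we write $x\sim y$ if $\omega(x,y)>0$. It is locally finite if each vertex has finitely many neighbors, and connected if any two vertices are joined by a path. Put $\Delta f(x)=\frac1{\mu(x)}\sum_{y}\omega(x,y)\,(f(y)-f(x))$. The heat kernel $k(x,y,t)$, $t\ge 0$, is the smallest nonnegative function that is, for all $x,y$, continuous in $t\in[0,\infty)$ and $C^1$ in $t\in(0,\infty)$, and satisfies $\partial_t k=\Delta_x k$ for $t>0$ and $k(x,y,0)=\delta_{xy}/\mu(x)$. Put $(P_t\varphi)(x)=\sum_{y}k(x,y,t)\,\varphi(y)\,\mu(y)$. The graph is stochastically complete if $\sum_{y}k(x,y,t)\,\mu(y)=1$ for all $x\in X$, $t>0$. **Proposition 3.7.** Let $(X,\omega,\mu)$ be a connected, locally finite and stochastically complete weighted graph, let $p>1$, and let $u_0:X\to[0,\infty)$ be bounded. Let $u:X\times[0,\infty)\to\mathbb R$ be a global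 classical solution of $$u_t-\Delta u=u^p\ \text{ in } X\times(0,\infty),\qquad u(\cdot,0)=u_0,$$ that is: $u(x,\cdot)\in C^1((0,\infty))\cap C^0([0,\infty))$ for every $x\in X$, $u$ is bounded on $X\times[0,T']$ for every $T'\in(0,\infty)$, $u\ge0$, and the equation and the initial condition hold pointwise. Then $u$ is a global mild solution of the same problem, that is: for every $\tau>0$, $u$ is nonnegative on $X\times[0,\tau]$, $u(x,\cdot)$ is measurable on $[0,\tau]$ for each $x$, $u$ is bounded on $X\times[0,\tau]$, $u(\cdot,0)=u_0$, and for every $x\in X$ and every $t\in(0,\tau]$ the function $s\mapsto \big(P_{t-s}[u(\cdot,s)^p]\big)(x)$ is Lebesgue integrable on $(0,t)$ and $$u(x,t)=(P_tu_0)(x)+\int_0^t\big(P_{t-s}[u(\cdot,s)^p]\big)(x)\,ds .$$ -/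

import Mathlib

open Set MeasureTheory

noncomputable section

/-- A weighted graph with vertex set `X`: a positive vertex measure `μ` and a symmetric,
nonnegative, summable edge weight `ω` vanishing on the diagonal. -/
structure WeightedGraph (X : Type*) where
  /-- edge weight -/
  ω : X → X → ℝ
  /-- vertex measure -/
  μ : X → ℝ
  μ_pos : ∀ x, 0 < μ x
  ω_nonneg : ∀ x y, 0 ≤ ω x y
  ω_self : ∀ x, ω x x = 0
  ω_symm : ∀ x y, ω x y = ω y x
  ω_summable : ∀ x, Summable (ω x)

namespace WeightedGraph

variable {X : Type*} (G : WeightedGraph X)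

/-- The underlying combinatorial graph: `x ∼ y` iff `ω x y > 0`. -/
def graph : SimpleGraph X where
  Adj x y := 0 < G.ω x y
  symm := ⟨fun x y h => by rw [G.ω_symm y x]; exact h⟩
  loopless := ⟨fun x h => by rw [G.ω_self x] at h; exact lt_irrefl _ h⟩

/-- Every vertex has finitely many neighbors. -/
def LocallyFinite : Prop := ∀ x, (G.graph.neighborSet x).Finite

/-- Any two vertices are joined by a path. -/
def IsConnected : Prop := G.graph.Connected

/-- The weighted Laplacian `Δ f (x) = (1 / μ x) ∑_y ω(x,y) (f y - f x)`.
On a locally finite graph the sum has finitely many nonzero terms, for every `f`. -/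
def laplacian (f : X → ℝ) (x : X) : ℝ :=
  (1 / G.μ x) * ∑' y, G.ω x y * (f y - f x)

/-- Time regularity of classical solutions on `X × [0, ∞)`: for every vertex,
`u x ∈ C¹((0, ∞)) ∩ C⁰([0, ∞))`. -/
def TimeRegular (u : X → ℝ → ℝ) : Prop :=
  ∀ x, ContDiffOn ℝ 1 (u x) (Ioi 0) ∧ ContinuousOn (u x) (Ici 0)

/-- `v` is a classical solution on `X × [0, ∞)` of `v_t - Δ v = 0`, `v(·, 0) = v₀`. -/
structure IsHeatSolution (v₀ : X → ℝ) (v : X → ℝ → ℝ) : Prop where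
  regular : TimeRegular v
  heat_eq : ∀ x, ∀ t, 0 < t → deriv (v x) t - G.laplacian (fun z => v z t) x = 0
  initial : ∀ x, v x 0 = v₀ x

open Classical in
/-- `q` is a nonnegative solution on `X × X × [0, ∞)` of `q_t - Δ q = 0` (with `Δ` acting in the
first vertex variable) with `q(x, y, 0) = δ_{xy} / μ(x)`. -/
def IsNonnegFundamentalSolution (q : X → X → ℝ → ℝ) : Prop :=
  (∀ x y, ∀ t, 0 ≤ t → 0 ≤ q x y t) ∧
  ∀ y, G.IsHeatSolution (fun x => if x = y then 1 / G.μ x else 0) (fun x t => q x y t)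

/-- The heat kernel, i.e. the smallest nonnegative fundamental solution of the heat equation,
as the pointwise infimum of all of them. (On a connected locally finite graph this infimum is
classically known to be itself a fundamental solution, symmetric in the two vertices.)
Only its values at times `t ≥ 0` are meaningful. -/
def heatKernel (x y : X) (t : ℝ) : ℝ :=
  sInf {a : ℝ | ∃ q, G.IsNonnegFundamentalSolution q ∧ a = q x y t}

/-- The heat semigroup `(P_t φ)(x) = ∑_y p(x,y,t) φ(y) μ(y)`. -/
def heatSemigroup (t : ℝ) (φ : X → ℝ) (x : X) : ℝ :=
  ∑' y, G.heatKernel x y t * φ y * G.μ y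

/-- `∑_y p(x,y,t) μ(y) = 1` for all vertices `x` and times `t > 0`. -/
def StochasticallyComplete : Prop :=
  ∀ x, ∀ t, 0 < t → HasSum (fun y => G.heatKernel x y t * G.μ y) 1

/-- `u` is a global classical solution (on `X × [0, ∞)`) of `u_t - Δ u = u ^ p`, `u(·, 0) = u₀`:
it has the classical time regularity, is bounded on `X × [0, T']` for every finite `T'`, solves
the problem pointwise and is nonnegative. Since `u x` is continuous and every vertex has positive
measure, `u ∈ L^∞(X × [0, T'])` is the same as boundedness at all points. -/
structure IsGlobalClassicalSolution (p : ℝ) (u₀ : X → ℝ) (u : X → ℝ → ℝ) : Prop where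
  regular : TimeRegular u
  bounded : ∀ T', 0 < T' → ∃ M, ∀ x, ∀ t ∈ Icc 0 T', |u x t| ≤ M
  equation : ∀ x, ∀ t, 0 < t → deriv (u x) t - G.laplacian (fun z => u z t) x = u x t ^ p
  initial : ∀ x, u x 0 = u₀ x
  nonneg : ∀ x, ∀ t, 0 < t → 0 ≤ u x t

/-- `u` is a mild solution on `[0, τ]` of `u_t - Δ u = u ^ p`, `u(·, 0) = u₀`: it is
nonnegative, measurable in time, bounded in `ℓ^∞(X)` uniformly on `[0, τ]`, has initial value
`u₀`, and satisfies Duhamel's formula at every vertex and every time in `(0, τ]`, the time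
integral being a convergent Lebesgue integral. -/
structure IsMildSolutionOn (p : ℝ) (u₀ : X → ℝ) (u : X → ℝ → ℝ) (τ : ℝ) : Prop where
  nonneg : ∀ x, ∀ t ∈ Icc 0 τ, 0 ≤ u x t
  measurable : ∀ x, AEStronglyMeasurable (u x) (volume.restrict (Icc 0 τ))
  bounded : ∃ M, ∀ x, ∀ t ∈ Icc 0 τ, |u x t| ≤ M
  initial : ∀ x, u x 0 = u₀ x
  integrable : ∀ x, ∀ t ∈ Ioc 0 τ,
    IntervalIntegrable (fun s => G.heatSemigroup (t - s) (fun y => u y s ^ p) x) volume 0 t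
  duhamel : ∀ x, ∀ t ∈ Ioc 0 τ,
    u x t = G.heatSemigroup t u₀ x
      + ∫ s in (0 : ℝ)..t, G.heatSemigroup (t - s) (fun y => u y s ^ p) x

/-- A global mild solution: a mild solution on `[0, τ]` for every `τ > 0`. -/
def IsGlobalMildSolution (p : ℝ) (u₀ : X → ℝ) (u : X → ℝ → ℝ) : Prop :=
  ∀ τ, 0 < τ → G.IsMildSolutionOn p u₀ u τ

end WeightedGraph

end

/-! Restrict the equation to a finite vertex set `S`. For a vertex of `S`, `Δ` is the Dirichlet
Laplacian of `S` plus the inflow from neighbours outside `S`, so Duhamel's formula for a linear ODE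
system gives u(t) = P^S_t u₀ + ∫ P^S_{t-s} u^p ds + ∫ P^S_{t-s} inflow(u(s)) ds. It remains to let
`S` grow to `X` and show that the last term vanishes.

If 0 ≤ u ≤ M on [0, t], positivity of P^S puts that term between 0 and M times the same term for the
constant function 1. Since Δ1 = 0, the formula applied to 1 evaluates it exactly: it is 1 - P^S_t 1,
the heat lost through the boundary (`integral_inflow_one`). Stochastic completeness says that this
loss tends to 0. The other two terms converge by dominated convergence.

Both limits need the Dirichlet kernels to converge to the heat kernel, here an infimum over
nonnegative fundamental solutions. The finite Duhamel formula with nonnegative inflow yields a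
comparison principle (`dirichletSemigroup_le`), so the Dirichlet kernels increase with `S` and lie
below every such solution. Their supremum is itself a fundamental solution, hence the smallest one
(`tendsto_dirichletKernel`). -/

noncomputable section

open Filter Topology
open scoped Classical

/-! ### Exponentials of bounded operators: Duhamel's formula and positivity -/

/-- Duhamel's formula for `w' = A w + f` with a bounded operator `A`. -/
theorem eq_exp_smul_add_integral {E : Type*} [NormedAddCommGroup E] [NormedSpace ℝ E]
    [CompleteSpace E] (A : E →L[ℝ] E) {w f : ℝ → E} {t : ℝ} (ht : 0 ≤ t)
    (hw : ContinuousOn w (Icc 0 t)) (hf : ContinuousOn f (Icc 0 t))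
    (hd : ∀ s ∈ Ioo 0 t, HasDerivAt w (A (w s) + f s) s) :
    w t = NormedSpace.exp (t • A) (w 0) +
      ∫ s in (0 : ℝ)..t, NormedSpace.exp ((t - s) • A) (f s) := by
  have hE : Continuous fun s : ℝ => NormedSpace.exp ((t - s) • A) :=
    (continuous_iff_continuousAt.2 fun s => (hasDerivAt_exp_smul_const A s).continuousAt).comp
      (continuous_const.sub continuous_id)
  have hI : ContinuousOn (fun s => NormedSpace.exp ((t - s) • A) (f s)) (Icc 0 t) :=
    hE.continuousOn.clm_apply hf
  have key := intervalIntegral.integral_eq_sub_of_hasDerivAt_of_le ht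
    (f := fun s => NormedSpace.exp ((t - s) • A) (w s))
    (f' := fun s => NormedSpace.exp ((t - s) • A) (f s))
    (hE.continuousOn.clm_apply hw) (fun s hs => by
      -- In the product rule the two terms containing `A (w s)` cancel and only the source `f s`
      -- survives.
      have h1 : HasDerivAt (fun s : ℝ => NormedSpace.exp ((t - s) • A))
          ((-1 : ℝ) • (NormedSpace.exp ((t - s) • A) * A)) s :=
        (hasDerivAt_exp_smul_const A (t - s)).scomp s
          (by simpa using (hasDerivAt_id s).const_sub t)
      convert h1.clm_apply (hd s hs) using 1
      simp) (hI.intervalIntegrable_of_Icc ht)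
  rw [key]
  simp

/-- The exponential of an operator preserving nonnegative functions preserves them too. -/
theorem exp_apply_nonneg {ι : Type*} [Fintype ι] (B : (ι → ℝ) →L[ℝ] (ι → ℝ))
    (hB : ∀ f, 0 ≤ f → 0 ≤ B f) {f : ι → ℝ} (hf : 0 ≤ f) : 0 ≤ NormedSpace.exp B f := by
  have h := (NormedSpace.exp_series_hasSum_exp' (𝕂 := ℝ) B).mapL
    (ContinuousLinearMap.apply ℝ (ι → ℝ) f)
  refine h.nonneg fun n => ?_
  have hpow : ∀ n : ℕ, 0 ≤ (B ^ n) f := by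
    intro n
    induction n with
    | zero => simpa using hf
    | succ n ih => rw [pow_succ']; exact hB _ ih
  simpa using smul_nonneg (by positivity : (0 : ℝ) ≤ ((n.factorial : ℝ))⁻¹) (hpow n)

/-- The scalar shift commutes with everything, so exp(tA) = e^{-tc} exp(t(A + c)), and A + c
preserves nonnegative functions. This handles generators with negative diagonal entries. -/
theorem exp_smul_apply_nonneg {ι : Type*} [Fintype ι] (A : (ι → ℝ) →L[ℝ] (ι → ℝ)) (c : ℝ)
    (hA : ∀ f, 0 ≤ f → 0 ≤ A f + c • f) {t : ℝ} (ht : 0 ≤ t) {f : ι → ℝ} (hf : 0 ≤ f) :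
    0 ≤ NormedSpace.exp (t • A) f := by
  have hcomm : Commute (t • (A + c • (1 : (ι → ℝ) →L[ℝ] (ι → ℝ))))
      (algebraMap ℝ ((ι → ℝ) →L[ℝ] (ι → ℝ)) (-(t * c))) := Algebra.commute_algebraMap_right _ _
  have hsplit : t • A = t • (A + c • (1 : (ι → ℝ) →L[ℝ] (ι → ℝ))) +
      algebraMap ℝ ((ι → ℝ) →L[ℝ] (ι → ℝ)) (-(t * c)) := by
    rw [Algebra.algebraMap_eq_smul_one, smul_add, smul_smul, neg_smul, add_neg_cancel_right]
  let := NormedAlgebra.restrictScalars ℚ ℝ ((ι → ℝ) →L[ℝ] (ι → ℝ))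
  rw [hsplit, NormedSpace.exp_add_of_commute hcomm, ← NormedSpace.algebraMap_exp_comm,
    Algebra.algebraMap_eq_smul_one, mul_smul_comm, mul_one, ← Real.exp_eq_exp_ℝ]
  refine smul_nonneg (Real.exp_pos _).le (exp_apply_nonneg _ (fun g hg => ?_) hf)
  exact smul_nonneg ht (hA g hg)

/-! ### Dirichlet Laplacian and semigroup of a finite vertex set -/

namespace WeightedGraph

variable {X : Type*} (G : WeightedGraph X)

theorem laplacian_eq_sum (hfin : G.LocallyFinite) (f : X → ℝ) (x : X) :
    G.laplacian f x = (1 / G.μ x) * ∑ y ∈ (hfin x).toFinset, G.ω x y * (f y - f x) := by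
  unfold laplacian
  rw [tsum_eq_sum]
  intro y hy
  have : ¬ 0 < G.ω x y := by simpa [graph, SimpleGraph.mem_neighborSet] using hy
  rw [le_antisymm (not_lt.1 this) (G.ω_nonneg x y), zero_mul]

/-- Extension by zero of a function on a finite vertex set. -/
def zeroExtend (S : Finset X) (f : S → ℝ) (x : X) : ℝ :=
  if h : x ∈ S then f ⟨x, h⟩ else 0

theorem zeroExtend_mem {S : Finset X} (f : S → ℝ) {x : X} (hx : x ∈ S) :
    zeroExtend S f x = f ⟨x, hx⟩ := by simp [zeroExtend, hx]

theorem zeroExtend_notMem {S : Finset X} (f : S → ℝ) {x : X} (hx : x ∉ S) :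
    zeroExtend S f x = 0 := by simp [zeroExtend, hx]

/-- The Laplacian on a finite vertex set with Dirichlet boundary condition. -/
def dirichletLaplacian (hfin : G.LocallyFinite) (S : Finset X) : (S → ℝ) →L[ℝ] (S → ℝ) :=
  LinearMap.toContinuousLinearMap
    { toFun := fun f x => G.laplacian (zeroExtend S f) x
      map_add' := fun f g => by
        ext x
        have : zeroExtend S (f + g) = zeroExtend S f + zeroExtend S g := by
          ext y; by_cases hy : y ∈ S <;> simp [zeroExtend, hy]
        simp only [G.laplacian_eq_sum hfin, this, Pi.add_apply, ← mul_add,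
          ← Finset.sum_add_distrib]
        congr 1
        exact Finset.sum_congr rfl fun y _ => by ring
      map_smul' := fun c f => by
        ext x
        have : zeroExtend S (c • f) = c • zeroExtend S f := by
          ext y; by_cases hy : y ∈ S <;> simp [zeroExtend, hy]
        simp only [G.laplacian_eq_sum hfin, this, Pi.smul_apply, smul_eq_mul, RingHom.id_apply,
          Finset.mul_sum]
        exact Finset.sum_congr rfl fun y _ => by ring }

theorem dirichletLaplacian_apply (hfin : G.LocallyFinite) (S : Finset X) (f : S → ℝ) (x : S) :
    G.dirichletLaplacian hfin S f x = G.laplacian (zeroExtend S f) x := rfl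

/-- The flow into the vertex `x` from outside `S`. -/
def inflow (hfin : G.LocallyFinite) (S : Finset X) (φ : X → ℝ) (x : X) : ℝ :=
  (1 / G.μ x) * ∑ y ∈ (hfin x).toFinset \ S, G.ω x y * φ y

theorem inflow_nonneg (hfin : G.LocallyFinite) (S : Finset X) {φ : X → ℝ} (hφ : ∀ x, 0 ≤ φ x)
    (x : X) : 0 ≤ G.inflow hfin S φ x :=
  mul_nonneg (one_div_nonneg.2 (G.μ_pos x).le)
    (Finset.sum_nonneg fun y _ => mul_nonneg (G.ω_nonneg x y) (hφ y))

theorem inflow_le (hfin : G.LocallyFinite) (S : Finset X) {φ : X → ℝ} {M : ℝ}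
    (hφ : ∀ x, φ x ≤ M) (x : X) : G.inflow hfin S φ x ≤ M * G.inflow hfin S 1 x := by
  unfold inflow
  rw [mul_left_comm, Finset.mul_sum (f := fun y => G.ω x y * (1 : X → ℝ) y) (a := M)]
  refine mul_le_mul_of_nonneg_left (Finset.sum_le_sum fun y _ => ?_)
    (one_div_nonneg.2 (G.μ_pos x).le)
  have := mul_le_mul_of_nonneg_left (hφ y) (G.ω_nonneg x y)
  simpa [mul_comm M] using this

theorem continuousOn_inflow (hfin : G.LocallyFinite) (S : Finset X) {v : X → ℝ → ℝ} {I : Set ℝ}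
    (hv : ∀ x, ContinuousOn (v x) I) (x : X) :
    ContinuousOn (fun s => G.inflow hfin S (fun z => v z s) x) I :=
  continuousOn_const.mul (continuousOn_finsetSum _ fun y _ => continuousOn_const.mul (hv y))

theorem continuousOn_laplacian (hfin : G.LocallyFinite) {v : X → ℝ → ℝ} {I : Set ℝ}
    (hv : ∀ x, ContinuousOn (v x) I) (x : X) :
    ContinuousOn (fun s => G.laplacian (fun z => v z s) x) I := by
  simp only [G.laplacian_eq_sum hfin]
  exact continuousOn_const.mul
    (continuousOn_finsetSum _ fun y _ => continuousOn_const.mul ((hv y).sub (hv x)))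

/-- Extension by zero keeps the loss -ω(x,y) φ(x) along edges leaving `S` and drops only the gain
ω(x,y) φ(y), which is the inflow. -/
theorem laplacian_eq_dirichletLaplacian_add_inflow (hfin : G.LocallyFinite) (S : Finset X)
    (φ : X → ℝ) (x : S) :
    G.laplacian φ x = G.dirichletLaplacian hfin S (fun y => φ y) x + G.inflow hfin S φ x := by
  rw [dirichletLaplacian_apply, G.laplacian_eq_sum hfin, G.laplacian_eq_sum hfin, inflow,
    ← mul_add]
  congr 1
  rw [← Finset.filter_notMem_eq_sdiff, Finset.sum_filter, ← Finset.sum_add_distrib]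
  refine Finset.sum_congr rfl fun y _ => ?_
  rw [zeroExtend_mem _ x.2]
  by_cases hy : y ∈ S
  · simp [hy, zeroExtend]
  · simp only [zeroExtend_notMem _ hy, hy, not_false_eq_true, if_true]; ring

/-- Only the diagonal entries -d(x), with d the weighted degree over μ, can be negative. The sum of
d over `S` bounds each of them. -/
theorem dirichletLaplacian_add_smul_nonneg (hfin : G.LocallyFinite) (S : Finset X) :
    ∃ c : ℝ, ∀ f : S → ℝ, 0 ≤ f → 0 ≤ G.dirichletLaplacian hfin S f + c • f := by
  set d : X → ℝ := fun x => (1 / G.μ x) * ∑ y ∈ (hfin x).toFinset, G.ω x y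
  have hd : ∀ x, 0 ≤ d x := fun x => mul_nonneg (one_div_nonneg.2 (G.μ_pos x).le)
    (Finset.sum_nonneg fun y _ => G.ω_nonneg x y)
  refine ⟨∑ x ∈ S, d x, fun f hf x => ?_⟩
  have h1 : d x * f x ≤ (∑ x ∈ S, d x) * f x :=
    mul_le_mul_of_nonneg_right (Finset.single_le_sum (fun y _ => hd y) x.2) (hf x)
  have h2 : 0 ≤ (1 / G.μ x) * ∑ y ∈ (hfin x).toFinset, G.ω x y * zeroExtend S f y := by
    refine mul_nonneg (one_div_nonneg.2 (G.μ_pos x).le)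
      (Finset.sum_nonneg fun y _ => mul_nonneg (G.ω_nonneg x y) ?_)
    by_cases hy : y ∈ S
    · rw [zeroExtend_mem _ hy]; exact hf _
    · rw [zeroExtend_notMem _ hy]
  have h3 : G.dirichletLaplacian hfin S f x =
      (1 / G.μ x) * ∑ y ∈ (hfin x).toFinset, G.ω x y * zeroExtend S f y - d x * f x := by
    rw [dirichletLaplacian_apply, G.laplacian_eq_sum hfin, zeroExtend_mem _ x.2]
    simp only [mul_sub, Finset.sum_sub_distrib, d, ← Finset.sum_mul, mul_assoc, Subtype.coe_eta]
  simp only [Pi.zero_apply, Pi.add_apply, Pi.smul_apply, smul_eq_mul]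
  linarith

/-- The Dirichlet heat semigroup of a finite vertex set. -/
def dirichletSemigroup (hfin : G.LocallyFinite) (S : Finset X) (t : ℝ) :
    (S → ℝ) →L[ℝ] (S → ℝ) :=
  NormedSpace.exp (t • G.dirichletLaplacian hfin S)

theorem dirichletSemigroup_zero (hfin : G.LocallyFinite) (S : Finset X) :
    G.dirichletSemigroup hfin S 0 = 1 := by simp [dirichletSemigroup]

theorem dirichletSemigroup_nonneg (hfin : G.LocallyFinite) (S : Finset X) {t : ℝ} (ht : 0 ≤ t)
    {f : S → ℝ} (hf : 0 ≤ f) : 0 ≤ G.dirichletSemigroup hfin S t f := by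
  obtain ⟨c, hc⟩ := G.dirichletLaplacian_add_smul_nonneg hfin S
  exact exp_smul_apply_nonneg _ c hc ht hf

theorem dirichletSemigroup_mono (hfin : G.LocallyFinite) (S : Finset X) {t : ℝ} (ht : 0 ≤ t)
    {f g : S → ℝ} (h : f ≤ g) :
    G.dirichletSemigroup hfin S t f ≤ G.dirichletSemigroup hfin S t g := by
  have := G.dirichletSemigroup_nonneg hfin S ht (sub_nonneg.2 h)
  rwa [map_sub, sub_nonneg] at this

theorem hasDerivAt_dirichletSemigroup (hfin : G.LocallyFinite) (S : Finset X) (f : S → ℝ)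
    (t : ℝ) : HasDerivAt (fun s => G.dirichletSemigroup hfin S s f)
      (G.dirichletLaplacian hfin S (G.dirichletSemigroup hfin S t f)) t := by
  have h := (hasDerivAt_exp_smul_const' (G.dirichletLaplacian hfin S) t).clm_apply
    (hasDerivAt_const t f)
  unfold dirichletSemigroup
  simpa using h

theorem continuous_dirichletSemigroup (hfin : G.LocallyFinite) (S : Finset X) :
    Continuous (G.dirichletSemigroup hfin S) :=
  continuous_iff_continuousAt.2 fun t =>
    (hasDerivAt_exp_smul_const (G.dirichletLaplacian hfin S) t).continuousAt

theorem continuousOn_dirichletSemigroup_apply (hfin : G.LocallyFinite) (S : Finset X) (t : ℝ)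
    {f : ℝ → S → ℝ} {I : Set ℝ} (hf : ContinuousOn f I) (x : S) :
    ContinuousOn (fun s => G.dirichletSemigroup hfin S (t - s) (f s) x) I :=
  (continuous_apply x).comp_continuousOn
    (((G.continuous_dirichletSemigroup hfin S).comp
      (continuous_const.sub continuous_id)).continuousOn.clm_apply hf)

/-- Duhamel's formula on a finite vertex set. -/
theorem eq_dirichletSemigroup_add_integral (hfin : G.LocallyFinite) (S : Finset X)
    {v g : X → ℝ → ℝ} {t : ℝ} (ht : 0 ≤ t) (hv : ∀ x, ContinuousOn (v x) (Icc 0 t))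
    (hg : ∀ x, ContinuousOn (g x) (Icc 0 t))
    (hd : ∀ x ∈ S, ∀ s ∈ Ioo 0 t,
      HasDerivAt (v x) (G.laplacian (fun z => v z s) x + g x s) s) (x : S) :
    v x t = G.dirichletSemigroup hfin S t (fun y => v y 0) x
      + (∫ s in (0 : ℝ)..t, G.dirichletSemigroup hfin S (t - s) (fun y => g y s) x)
      + ∫ s in (0 : ℝ)..t,
          G.dirichletSemigroup hfin S (t - s) (fun y => G.inflow hfin S (fun z => v z s) y) x := by
  have hgc : ContinuousOn (fun s (y : S) => g y s) (Icc 0 t) := continuousOn_pi.2 fun y => hg y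
  have hic : ContinuousOn (fun s (y : S) => G.inflow hfin S (fun z => v z s) y) (Icc 0 t) :=
    continuousOn_pi.2 fun y => G.continuousOn_inflow hfin S hv y
  have hH : ∀ f : ℝ → S → ℝ, ContinuousOn f (Icc 0 t) →
      IntervalIntegrable (fun s => G.dirichletSemigroup hfin S (t - s) (f s)) volume 0 t :=
    fun f hf => (continuousOn_pi.2 fun y =>
      G.continuousOn_dirichletSemigroup_apply hfin S t hf y).intervalIntegrable_of_Icc ht
  have key := eq_exp_smul_add_integral (G.dirichletLaplacian hfin S)
    (w := fun s (y : S) => v y s)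
    (f := fun s => (fun y : S => g y s) + fun y : S => G.inflow hfin S (fun z => v z s) y)
    ht (continuousOn_pi.2 fun y => hv y) (hgc.add hic) (fun s hs => by
      refine hasDerivAt_pi.2 fun y => ?_
      have h := hd y y.2 s hs
      rw [G.laplacian_eq_dirichletLaplacian_add_inflow hfin S] at h
      exact h.congr_deriv (add_right_comm _ _ _ |>.trans (add_assoc _ _ _)))
  have key' := congrFun key x
  have hproj : ∀ F : ℝ → S → ℝ, IntervalIntegrable F volume 0 t →
      ∫ s in (0 : ℝ)..t, F s x = (∫ s in (0 : ℝ)..t, F s) x := fun F hF =>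
    (ContinuousLinearMap.proj (R := ℝ) (φ := fun _ : S => ℝ) x).intervalIntegral_comp_comm hF
  rw [hproj _ (hH _ hgc), hproj _ (hH _ hic), add_assoc, ← Pi.add_apply (∫ s in (0 : ℝ)..t, _),
    ← intervalIntegral.integral_add (hH _ hgc) (hH _ hic)]
  simpa only [dirichletSemigroup, map_add, Pi.add_apply] using key'

/-- Comparison principle: in Duhamel's formula with zero source, a nonnegative solution exceeds the
Dirichlet evolution of its initial data by the inflow integral, which is nonnegative. -/
theorem dirichletSemigroup_le (hfin : G.LocallyFinite) (S : Finset X)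
    {v : X → ℝ → ℝ} {t : ℝ} (ht : 0 ≤ t) (hv : ∀ x, ContinuousOn (v x) (Icc 0 t))
    (hd : ∀ x ∈ S, ∀ s ∈ Ioo 0 t, HasDerivAt (v x) (G.laplacian (fun z => v z s) x) s)
    (h0 : ∀ x, ∀ s ∈ Icc 0 t, 0 ≤ v x s) (x : S) :
    G.dirichletSemigroup hfin S t (fun y => v y 0) x ≤ v x t := by
  have h := G.eq_dirichletSemigroup_add_integral hfin S (v := v) (g := fun _ _ => 0) ht hv
    (fun _ => continuousOn_const) (fun x hx s hs => by simpa using hd x hx s hs) x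
  have hz : ∀ s, G.dirichletSemigroup hfin S (t - s) (fun _ => (0 : ℝ)) x = 0 := fun s =>
    congrFun (map_zero (G.dirichletSemigroup hfin S (t - s))) x
  simp only [hz, intervalIntegral.integral_zero, add_zero] at h
  rw [h, le_add_iff_nonneg_right]
  refine intervalIntegral.integral_nonneg ht fun s hs => ?_
  exact G.dirichletSemigroup_nonneg hfin S (sub_nonneg.2 hs.2)
    (fun y => G.inflow_nonneg hfin S (fun z => h0 z s hs) y) x

end WeightedGraph

/-! ### Dirichlet kernels and their convergence to the heat kernel -/

namespace WeightedGraph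

variable {X : Type*} (G : WeightedGraph X)

theorem TimeRegular.hasDerivAt {u : X → ℝ → ℝ} (hu : TimeRegular u) (x : X) {t : ℝ} (ht : 0 < t) :
    HasDerivAt (u x) (deriv (u x) t) t :=
  (((hu x).1.differentiableOn one_ne_zero).differentiableAt (Ioi_mem_nhds ht)).hasDerivAt

theorem TimeRegular.continuousOn_Icc {u : X → ℝ → ℝ} (hu : TimeRegular u) (x : X) (t : ℝ) :
    ContinuousOn (u x) (Icc 0 t) :=
  (hu x).2.mono fun _ hs => hs.1

/-- The Dirichlet heat kernel of a finite vertex set. -/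
def dirichletKernel (hfin : G.LocallyFinite) (S : Finset X) (x y : X) (t : ℝ) : ℝ :=
  zeroExtend S (G.dirichletSemigroup hfin S t fun z => if (z : X) = y then 1 / G.μ z else 0) x

theorem dirichletKernel_mem (hfin : G.LocallyFinite) {S : Finset X} {x : X} (hx : x ∈ S)
    (y : X) (t : ℝ) : G.dirichletKernel hfin S x y t =
      G.dirichletSemigroup hfin S t (fun z => if (z : X) = y then 1 / G.μ z else 0) ⟨x, hx⟩ :=
  zeroExtend_mem _ hx

theorem dirichletKernel_notMem (hfin : G.LocallyFinite) {S : Finset X} {x : X} (hx : x ∉ S)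
    (y : X) (t : ℝ) : G.dirichletKernel hfin S x y t = 0 :=
  zeroExtend_notMem _ hx

theorem delta_nonneg (x y : X) : 0 ≤ if x = y then 1 / G.μ x else 0 := by
  split_ifs
  exacts [one_div_nonneg.2 (G.μ_pos x).le, le_rfl]

theorem dirichletKernel_nonneg (hfin : G.LocallyFinite) (S : Finset X) (x y : X) {t : ℝ}
    (ht : 0 ≤ t) : 0 ≤ G.dirichletKernel hfin S x y t := by
  by_cases hx : x ∈ S
  · rw [G.dirichletKernel_mem hfin hx]
    exact G.dirichletSemigroup_nonneg hfin S ht (fun z => G.delta_nonneg z y) _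
  · rw [G.dirichletKernel_notMem hfin hx]

theorem dirichletKernel_zero (hfin : G.LocallyFinite) {S : Finset X} {x : X} (hx : x ∈ S)
    (y : X) : G.dirichletKernel hfin S x y 0 = if x = y then 1 / G.μ x else 0 := by
  rw [G.dirichletKernel_mem hfin hx, dirichletSemigroup_zero]
  rfl

theorem hasDerivAt_dirichletKernel (hfin : G.LocallyFinite) {S : Finset X} {x : X} (hx : x ∈ S)
    (y : X) (t : ℝ) : HasDerivAt (G.dirichletKernel hfin S x y)
      (G.laplacian (fun z => G.dirichletKernel hfin S z y t) x) t := by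
  have h := hasDerivAt_pi.1 (G.hasDerivAt_dirichletSemigroup hfin S
    (fun z => if (z : X) = y then 1 / G.μ z else 0) t) ⟨x, hx⟩
  have he : G.dirichletKernel hfin S x y = fun s => G.dirichletSemigroup hfin S s
      (fun z => if (z : X) = y then 1 / G.μ z else 0) ⟨x, hx⟩ :=
    funext fun s => G.dirichletKernel_mem hfin hx y s
  rw [he]
  exact h

theorem continuous_dirichletKernel (hfin : G.LocallyFinite) (S : Finset X) (x y : X) :
    Continuous (G.dirichletKernel hfin S x y) := by
  by_cases hx : x ∈ S
  · exact continuous_iff_continuousAt.2 fun t =>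
      (G.hasDerivAt_dirichletKernel hfin hx y t).continuousAt
  · have : G.dirichletKernel hfin S x y = fun _ => 0 :=
      funext fun s => G.dirichletKernel_notMem hfin hx y s
    rw [this]; exact continuous_const

/-- Expand φ in the normalised point masses δ_y / μ(y), with coefficients φ(y) μ(y). No symmetry of
the kernel is needed. -/
theorem dirichletSemigroup_eq_sum (hfin : G.LocallyFinite) (S : Finset X) (t : ℝ) (φ : X → ℝ)
    (x : S) : G.dirichletSemigroup hfin S t (fun y => φ y) x =
      ∑ y ∈ S, G.dirichletKernel hfin S x y t * φ y * G.μ y := by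
  have hφ : (fun y : S => φ y) =
      ∑ y : S, (φ y * G.μ y) • fun z : S => if (z : X) = y then 1 / G.μ z else 0 := by
    ext z
    rw [Finset.sum_apply, Finset.sum_eq_single z]
    · have := (G.μ_pos z).ne'
      simp only [Pi.smul_apply, if_true, smul_eq_mul]
      field_simp
    · intro b _ hb
      have : ¬ (z : X) = b := fun h => hb (Subtype.ext h.symm)
      simp only [Pi.smul_apply, if_neg this, smul_zero]
    · simp
  rw [hφ, map_sum, Finset.sum_apply, ← Finset.sum_coe_sort S]
  refine Finset.sum_congr rfl fun y _ => ?_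
  rw [map_smul, Pi.smul_apply, smul_eq_mul, G.dirichletKernel_mem hfin x.2]
  ring

theorem dirichletKernel_eq_zero (hfin : G.LocallyFinite) {S : Finset X} {y : X} (hy : y ∉ S)
    (x : X) (t : ℝ) : G.dirichletKernel hfin S x y t = 0 := by
  have h0 : (fun z : S => if (z : X) = y then 1 / G.μ z else 0) = 0 := by
    ext z
    have : (z : X) ≠ y := fun h => hy (h ▸ z.2)
    simp [this]
  by_cases hx : x ∈ S
  · rw [G.dirichletKernel_mem hfin hx, h0, map_zero, Pi.zero_apply]
  · exact G.dirichletKernel_notMem hfin hx y t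

/-- With an index set independent of `S`, dominated convergence for series becomes applicable as `S`
grows. -/
theorem dirichletSemigroup_eq_tsum (hfin : G.LocallyFinite) (S : Finset X) (t : ℝ) (φ : X → ℝ)
    (x : S) : G.dirichletSemigroup hfin S t (fun y => φ y) x =
      ∑' y, G.dirichletKernel hfin S x y t * φ y * G.μ y := by
  rw [G.dirichletSemigroup_eq_sum, tsum_eq_sum]
  intro y hy
  rw [G.dirichletKernel_eq_zero hfin hy, zero_mul, zero_mul]

theorem dirichletKernel_le (hfin : G.LocallyFinite) (S : Finset X) {q : X → X → ℝ → ℝ}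
    (hq : G.IsNonnegFundamentalSolution q) (x y : X) {t : ℝ} (ht : 0 ≤ t) :
    G.dirichletKernel hfin S x y t ≤ q x y t := by
  by_cases hx : x ∈ S
  · have h := G.dirichletSemigroup_le hfin S (v := fun x t => q x y t) ht
      (fun x => (hq.2 y).regular.continuousOn_Icc x t)
      (fun x _ s hs => ((hq.2 y).regular.hasDerivAt x hs.1).congr_deriv
        (sub_eq_zero.1 ((hq.2 y).heat_eq x s hs.1)))
      (fun x s hs => hq.1 x y s hs.1) ⟨x, hx⟩
    rw [G.dirichletKernel_mem hfin hx]
    simpa only [(hq.2 y).initial] using h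
  · rw [G.dirichletKernel_notMem hfin hx]
    exact hq.1 x y t ht

/-- The kernel of the larger set is a nonnegative solution on the smaller one with the same initial
data there, so the comparison principle applies. -/
theorem dirichletKernel_mono (hfin : G.LocallyFinite) (x y : X) {t : ℝ} (ht : 0 ≤ t) :
    Monotone fun S => G.dirichletKernel hfin S x y t := by
  intro S T hST
  by_cases hx : x ∈ S
  · have h := G.dirichletSemigroup_le hfin S
      (v := fun x t => G.dirichletKernel hfin T x y t) ht
      (fun x => (G.continuous_dirichletKernel hfin T x y).continuousOn)
      (fun x hx s _ => G.hasDerivAt_dirichletKernel hfin (hST hx) y s)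
      (fun x s hs => G.dirichletKernel_nonneg hfin T x y hs.1) ⟨x, hx⟩
    have hz : (fun z : S => G.dirichletKernel hfin T z y 0) =
        fun z : S => if (z : X) = y then 1 / G.μ z else 0 :=
      funext fun z => G.dirichletKernel_zero hfin (hST z.2) y
    simp only [hz] at h
    simpa only [G.dirichletKernel_mem hfin hx] using h
  · simp only [G.dirichletKernel_notMem hfin hx]
    exact G.dirichletKernel_nonneg hfin T x y ht

theorem abs_laplacian_le (hfin : G.LocallyFinite) {f b : X → ℝ} (h : ∀ x, |f x| ≤ b x) (x : X) :
    |G.laplacian f x| ≤ (1 / G.μ x) * ∑ y ∈ (hfin x).toFinset, G.ω x y * (b y + b x) := by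
  have hμ : 0 ≤ 1 / G.μ x := one_div_nonneg.2 (G.μ_pos x).le
  rw [G.laplacian_eq_sum hfin, abs_mul, abs_of_nonneg hμ]
  refine mul_le_mul_of_nonneg_left ((Finset.abs_sum_le_sum_abs _ _).trans
    (Finset.sum_le_sum fun y _ => ?_)) hμ
  rw [abs_mul, abs_of_nonneg (G.ω_nonneg x y)]
  exact mul_le_mul_of_nonneg_left ((abs_sub _ _).trans (add_le_add (h y) (h x)))
    (G.ω_nonneg x y)

theorem tendsto_laplacian (hfin : G.LocallyFinite) {ι : Type*} {l : Filter ι} {f : ι → X → ℝ}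
    {g : X → ℝ} (h : ∀ x, Tendsto (fun i => f i x) l (𝓝 (g x))) (x : X) :
    Tendsto (fun i => G.laplacian (f i) x) l (𝓝 (G.laplacian g x)) := by
  simp only [G.laplacian_eq_sum hfin]
  exact tendsto_const_nhds.mul
    (tendsto_finsetSum _ fun y _ => tendsto_const_nhds.mul ((h y).sub (h x)))

/-- The supremum of the Dirichlet heat kernels over all finite vertex sets. -/
def exhaustionKernel (hfin : G.LocallyFinite) (x y : X) (t : ℝ) : ℝ :=
  ⨆ S, G.dirichletKernel hfin S x y t

section

variable {G}
variable {q : X → X → ℝ → ℝ}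

theorem tendsto_exhaustionKernel (hfin : G.LocallyFinite)
    (hq : G.IsNonnegFundamentalSolution q) (x y : X) {t : ℝ} (ht : 0 ≤ t) :
    Tendsto (fun S => G.dirichletKernel hfin S x y t) atTop
      (𝓝 (G.exhaustionKernel hfin x y t)) :=
  tendsto_atTop_ciSup (G.dirichletKernel_mono hfin x y ht)
    ⟨q x y t, by rintro _ ⟨S, rfl⟩; exact G.dirichletKernel_le hfin S hq x y ht⟩

/-- The heat equation passes to the limit in integrated form by dominated convergence. Any
fundamental solution `q` lies above all Dirichlet kernels, and local finiteness turns it into a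
continuous dominating function for their Laplacians. Countability of `X` makes `atTop` on finite
sets countably generated. -/
theorem exhaustionKernel_integral [Countable X] (hfin : G.LocallyFinite)
    (hq : G.IsNonnegFundamentalSolution q) (x y : X) {t : ℝ} (ht : 0 ≤ t) :
    IntervalIntegrable (fun s => G.laplacian (fun z => G.exhaustionKernel hfin z y s) x)
      volume 0 t ∧
    G.exhaustionKernel hfin x y t = (if x = y then 1 / G.μ x else 0) +
      ∫ s in (0 : ℝ)..t, G.laplacian (fun z => G.exhaustionKernel hfin z y s) x := by
  set b : ℝ → ℝ := fun s =>
    (1 / G.μ x) * ∑ z ∈ (hfin x).toFinset, G.ω x z * (q z y s + q x y s)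
  have hqc : ∀ z, ContinuousOn (q z y) (Icc 0 t) := fun z => (hq.2 y).regular.continuousOn_Icc z t
  have hb : IntervalIntegrable b volume 0 t := by
    refine ContinuousOn.intervalIntegrable_of_Icc ht ?_
    exact continuousOn_const.mul (continuousOn_finsetSum _ fun z _ =>
      continuousOn_const.mul ((hqc z).add (hqc x)))
  have hcont : ∀ S, Continuous fun s => G.laplacian (fun z => G.dirichletKernel hfin S z y s) x :=
    fun S => continuousOn_univ.1 (G.continuousOn_laplacian hfin
      (fun z => (G.continuous_dirichletKernel hfin S z y).continuousOn) x)
  have hbound : ∀ S, ∀ s ∈ Ioc 0 t,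
      ‖G.laplacian (fun z => G.dirichletKernel hfin S z y s) x‖ ≤ b s := fun S s hs =>
    G.abs_laplacian_le hfin (b := fun z => q z y s) (fun z => by
      rw [abs_of_nonneg (G.dirichletKernel_nonneg hfin S z y hs.1.le)]
      exact G.dirichletKernel_le hfin S hq z y hs.1.le) x
  have hlim : ∀ s ∈ Ioc 0 t,
      Tendsto (fun S => G.laplacian (fun z => G.dirichletKernel hfin S z y s) x) atTop
        (𝓝 (G.laplacian (fun z => G.exhaustionKernel hfin z y s) x)) := fun s hs =>
    G.tendsto_laplacian hfin (fun z => tendsto_exhaustionKernel hfin hq z y hs.1.le) x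
  have hae : ∀ᵐ s ∂(volume.restrict (Ioc 0 t)), s ∈ Ioc 0 t :=
    ae_restrict_mem measurableSet_Ioc
  refine ⟨?_, ?_⟩
  · refine (intervalIntegrable_iff_integrableOn_Ioc_of_le ht).2 (Integrable.mono'
      ((intervalIntegrable_iff_integrableOn_Ioc_of_le ht).1 hb) ?_ ?_)
    · exact aestronglyMeasurable_of_tendsto_ae atTop
        (fun S => (hcont S).aestronglyMeasurable) (hae.mono fun s hs => hlim s hs)
    · exact hae.mono fun s hs => le_of_tendsto (hlim s hs).norm
        (Eventually.of_forall fun S => hbound S s hs)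
  · have h1 : Tendsto (fun S => (if x = y then 1 / G.μ x else 0) +
        ∫ s in (0 : ℝ)..t, G.laplacian (fun z => G.dirichletKernel hfin S z y s) x) atTop
        (𝓝 ((if x = y then 1 / G.μ x else 0) +
          ∫ s in (0 : ℝ)..t, G.laplacian (fun z => G.exhaustionKernel hfin z y s) x)) := by
      refine tendsto_const_nhds.add
        (intervalIntegral.tendsto_integral_filter_of_dominated_convergence b
          (Eventually.of_forall fun S => (hcont S).aestronglyMeasurable)
          (Eventually.of_forall fun S => Eventually.of_forall fun s hs => ?_) hb
          (Eventually.of_forall fun s hs => ?_))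
      · rw [uIoc_of_le ht] at hs
        exact hbound S s hs
      · rw [uIoc_of_le ht] at hs
        exact hlim s hs
    refine tendsto_nhds_unique (tendsto_exhaustionKernel hfin hq x y ht) (h1.congr' ?_)
    -- The Dirichlet kernel solves the heat equation only at vertices of `S`, so `S` must contain
    -- `x`.
    filter_upwards [eventually_ge_atTop ({x} : Finset X)] with S hS
    have hx : x ∈ S := hS (Finset.mem_singleton_self x)
    rw [intervalIntegral.integral_eq_sub_of_hasDerivAt
      (fun s _ => G.hasDerivAt_dirichletKernel hfin hx y s) ((hcont S).intervalIntegrable _ _),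
      G.dirichletKernel_zero hfin hx, add_sub_cancel]

theorem continuousOn_exhaustionKernel [Countable X] (hfin : G.LocallyFinite)
    (hq : G.IsNonnegFundamentalSolution q) (x y : X) :
    ContinuousOn (G.exhaustionKernel hfin x y) (Ici 0) := by
  intro t ht
  have ht' : (0 : ℝ) ≤ t + 1 := add_nonneg ht zero_le_one
  have h : ContinuousOn (G.exhaustionKernel hfin x y) (Icc 0 (t + 1)) := by
    have hI := (exhaustionKernel_integral hfin hq x y ht').1
    have hc := intervalIntegral.continuousOn_primitive_interval'
      hI (left_mem_uIcc)
    rw [uIcc_of_le ht'] at hc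
    refine (continuousOn_const.add hc).congr fun s hs =>
      (exhaustionKernel_integral hfin hq x y hs.1).2
  refine (h t ⟨ht, by linarith⟩).mono_of_mem_nhdsWithin ?_
  rw [← Ici_inter_Iic]
  exact inter_mem_nhdsWithin _ (Iic_mem_nhds (by linarith))

/-- Bootstrap: the integrated equation makes the kernel continuous in time, hence so is its
Laplacian. The fundamental theorem of calculus then gives a continuous derivative. -/
theorem isNonnegFundamentalSolution_exhaustionKernel [Countable X] (hfin : G.LocallyFinite)
    (hq : G.IsNonnegFundamentalSolution q) :
    G.IsNonnegFundamentalSolution (G.exhaustionKernel hfin) := by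
  have hcΔ := fun x y => G.continuousOn_laplacian hfin
    (fun z => continuousOn_exhaustionKernel hfin hq z y) x
  have hderiv : ∀ x y, ∀ t, 0 < t → HasDerivAt (G.exhaustionKernel hfin x y)
      (G.laplacian (fun z => G.exhaustionKernel hfin z y t) x) t := by
    intro x y t ht
    have hcat := (hcΔ x y).mono Ioi_subset_Ici_self
    have h := (intervalIntegral.integral_hasDerivAt_right
      (exhaustionKernel_integral hfin hq x y ht.le).1
      (hcat.stronglyMeasurableAtFilter isOpen_Ioi t ht)
      (hcat.continuousAt (Ioi_mem_nhds ht))).const_add (if x = y then 1 / G.μ x else 0)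
    refine h.congr_of_eventuallyEq ?_
    filter_upwards [Ioi_mem_nhds ht] with s hs
    exact (exhaustionKernel_integral hfin hq x y (le_of_lt hs)).2
  refine ⟨fun x y t ht => Real.iSup_nonneg fun S => G.dirichletKernel_nonneg hfin S x y ht,
    fun y => ⟨fun x => ⟨?_, continuousOn_exhaustionKernel hfin hq x y⟩,
      fun x t ht => sub_eq_zero.2 (hderiv x y t ht).deriv, fun x => ?_⟩⟩
  · refine (contDiffOn_succ_iff_deriv_of_isOpen (n := 0) isOpen_Ioi).2
      ⟨fun t ht => (hderiv x y t ht).differentiableAt.differentiableWithinAt, by simp, ?_⟩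
    rw [contDiffOn_zero]
    exact ((hcΔ x y).mono Ioi_subset_Ici_self).congr fun t ht => (hderiv x y t ht).deriv
  · rw [(exhaustionKernel_integral hfin hq x y le_rfl).2, intervalIntegral.integral_same, add_zero]

theorem heatKernel_le (hq : G.IsNonnegFundamentalSolution q) (x y : X) {t : ℝ} (ht : 0 ≤ t) :
    G.heatKernel x y t ≤ q x y t :=
  csInf_le ⟨0, by rintro _ ⟨q', hq', rfl⟩; exact hq'.1 x y t ht⟩ ⟨q, hq, rfl⟩

theorem dirichletKernel_le_heatKernel (hfin : G.LocallyFinite)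
    (hq : G.IsNonnegFundamentalSolution q) (S : Finset X) (x y : X) {t : ℝ} (ht : 0 ≤ t) :
    G.dirichletKernel hfin S x y t ≤ G.heatKernel x y t :=
  le_csInf ⟨_, q, hq, rfl⟩ (by
    rintro _ ⟨q', hq', rfl⟩; exact G.dirichletKernel_le hfin S hq' x y ht)

theorem tendsto_dirichletKernel [Countable X] (hfin : G.LocallyFinite)
    (hq : G.IsNonnegFundamentalSolution q) (x y : X) {t : ℝ} (ht : 0 ≤ t) :
    Tendsto (fun S => G.dirichletKernel hfin S x y t) atTop (𝓝 (G.heatKernel x y t)) := by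
  have h := tendsto_exhaustionKernel hfin hq x y ht
  have he : G.heatKernel x y t = G.exhaustionKernel hfin x y t := le_antisymm
    (heatKernel_le (isNonnegFundamentalSolution_exhaustionKernel hfin hq) x y ht)
    (ciSup_le fun S => dirichletKernel_le_heatKernel hfin hq S x y ht)
  rwa [he]

/-- Without any fundamental solution the infimum defining the heat kernel would be `sInf ∅ = 0`, and
a zero kernel cannot have total mass 1. -/
theorem StochasticallyComplete.exists_isNonnegFundamentalSolution [Nonempty X]
    (hsc : G.StochasticallyComplete) : ∃ q, G.IsNonnegFundamentalSolution q := by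
  by_contra hne
  have h0 : ∀ x y t, G.heatKernel x y t = 0 := by
    intro x y t
    have : {a : ℝ | ∃ q, G.IsNonnegFundamentalSolution q ∧ a = q x y t} = ∅ :=
      eq_empty_of_forall_notMem fun a ⟨q, hq, _⟩ => hne ⟨q, hq⟩
    rw [heatKernel, this, Real.sInf_empty]
  have h := hsc (Classical.arbitrary X) 1 one_pos
  simp only [h0, zero_mul] at h
  exact zero_ne_one (hasSum_zero.unique h)

end

end WeightedGraph

/-! ### Duhamel's formula under stochastic completeness -/

namespace WeightedGraph

variable {X : Type*} {G : WeightedGraph X}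

/-- The Dirichlet kernel lies below the heat kernel, whose total mass is 1. The bound is uniform in
`S` and `t`, so it serves as a constant dominating function in time. -/
theorem norm_tsum_dirichletKernel_le [Nonempty X] (hfin : G.LocallyFinite)
    (hsc : G.StochasticallyComplete) (S : Finset X) {t : ℝ} (ht : 0 < t) {φ : X → ℝ} {M : ℝ}
    (hφ : ∀ y, |φ y| ≤ M) (x : X) :
    ‖∑' y, G.dirichletKernel hfin S x y t * φ y * G.μ y‖ ≤ M := by
  obtain ⟨q, hq⟩ := hsc.exists_isNonnegFundamentalSolution
  refine tsum_of_norm_bounded (by simpa using (hsc x t ht).mul_left M) fun y => ?_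
  have h0 := G.dirichletKernel_nonneg hfin S x y ht.le
  rw [norm_mul, norm_mul, Real.norm_of_nonneg h0, Real.norm_of_nonneg (G.μ_pos y).le,
    Real.norm_eq_abs, mul_comm _ |φ y|, mul_assoc]
  have hμ := (G.μ_pos y).le
  exact mul_le_mul (hφ y) (mul_le_mul_of_nonneg_right
    (dirichletKernel_le_heatKernel hfin hq S x y ht.le) hμ) (mul_nonneg h0 hμ)
    ((abs_nonneg _).trans (hφ y))

theorem tendsto_tsum_dirichletKernel [Countable X] [Nonempty X] (hfin : G.LocallyFinite)
    (hsc : G.StochasticallyComplete) {t : ℝ} (ht : 0 < t) {φ : X → ℝ} {M : ℝ}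
    (hφ : ∀ y, |φ y| ≤ M) (x : X) :
    Tendsto (fun S => ∑' y, G.dirichletKernel hfin S x y t * φ y * G.μ y) atTop
      (𝓝 (G.heatSemigroup t φ x)) := by
  obtain ⟨q, hq⟩ := hsc.exists_isNonnegFundamentalSolution
  refine tendsto_tsum_of_dominated_convergence ((hsc x t ht).summable.mul_left M)
    (fun y => ((tendsto_dirichletKernel hfin hq x y ht.le).mul_const _).mul_const _)
    (Eventually.of_forall fun S y => ?_)
  have h0 := G.dirichletKernel_nonneg hfin S x y ht.le
  rw [norm_mul, norm_mul, Real.norm_of_nonneg h0, Real.norm_of_nonneg (G.μ_pos y).le,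
    Real.norm_eq_abs, mul_comm _ |φ y|, mul_assoc]
  have hμ := (G.μ_pos y).le
  exact mul_le_mul (hφ y) (mul_le_mul_of_nonneg_right
    (dirichletKernel_le_heatKernel hfin hq S x y ht.le) hμ) (mul_nonneg h0 hμ)
    ((abs_nonneg _).trans (hφ y))

theorem heatSemigroup_one (hsc : G.StochasticallyComplete) {t : ℝ} (ht : 0 < t) (x : X) :
    G.heatSemigroup t 1 x = 1 := by
  simpa [heatSemigroup] using (hsc x t ht).tsum_eq

/-- The constant 1 solves the heat equation, so its finite Duhamel formula identifies the inflow
integral with the lost mass. -/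
theorem integral_inflow_one (hfin : G.LocallyFinite) (S : Finset X) {t : ℝ} (ht : 0 ≤ t)
    (x : S) : ∫ s in (0 : ℝ)..t,
      G.dirichletSemigroup hfin S (t - s) (fun y => G.inflow hfin S 1 y) x =
      1 - ∑' y, G.dirichletKernel hfin S x y t * (1 : X → ℝ) y * G.μ y := by
  have h := G.eq_dirichletSemigroup_add_integral hfin S (v := fun _ _ => 1) (g := fun _ _ => 0) ht
    (fun _ => continuousOn_const) (fun _ => continuousOn_const)
    (fun y _ s _ => (hasDerivAt_const s (1 : ℝ)).congr_deriv
      (by simp [G.laplacian_eq_sum hfin])) x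
  have hz : ∀ s, G.dirichletSemigroup hfin S (t - s) (fun _ => (0 : ℝ)) x = 0 := fun s =>
    congrFun (map_zero (G.dirichletSemigroup hfin S (t - s))) x
  simp only [hz, intervalIntegral.integral_zero, add_zero] at h
  rw [← G.dirichletSemigroup_eq_tsum hfin S t 1 x]
  exact eq_sub_of_add_eq' h.symm

/-- Truncating Duhamel's formula to a finite vertex set costs at most `M` times the heat lost
through the boundary. -/
theorem abs_sub_truncated_duhamel_le (hfin : G.LocallyFinite) (S : Finset X)
    {v g : X → ℝ → ℝ} {t M : ℝ} (ht : 0 ≤ t) (hv : ∀ x, ContinuousOn (v x) (Icc 0 t))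
    (hg : ∀ x, ContinuousOn (g x) (Icc 0 t))
    (hd : ∀ x ∈ S, ∀ s ∈ Ioo 0 t,
      HasDerivAt (v x) (G.laplacian (fun z => v z s) x + g x s) s)
    (h0 : ∀ x, ∀ s ∈ Icc 0 t, 0 ≤ v x s) (hM : ∀ x, ∀ s ∈ Icc 0 t, v x s ≤ M)
    {x : X} (hx : x ∈ S) :
    |v x t - ((∑' y, G.dirichletKernel hfin S x y t * v y 0 * G.μ y) +
      ∫ s in (0 : ℝ)..t, ∑' y, G.dirichletKernel hfin S x y (t - s) * g y s * G.μ y)| ≤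
      M * (1 - ∑' y, G.dirichletKernel hfin S x y t * (1 : X → ℝ) y * G.μ y) := by
  have h := G.eq_dirichletSemigroup_add_integral hfin S ht hv hg hd ⟨x, hx⟩
  simp only [fun s => G.dirichletSemigroup_eq_tsum hfin S (t - s) (fun y => g y s) ⟨x, hx⟩,
    G.dirichletSemigroup_eq_tsum hfin S t (fun y => v y 0) ⟨x, hx⟩] at h
  -- The error is exactly the inflow integral of `v`, and the bound is that of the constant `M`. The
  -- integrands are compared pointwise.
  rw [← integral_inflow_one hfin S ht ⟨x, hx⟩, ← intervalIntegral.integral_const_mul,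
    sub_eq_of_eq_add' h]
  have hi1 : IntervalIntegrable (fun s => G.dirichletSemigroup hfin S (t - s)
      (fun y => G.inflow hfin S (fun z => v z s) y) ⟨x, hx⟩) volume 0 t :=
    (G.continuousOn_dirichletSemigroup_apply hfin S t (continuousOn_pi.2 fun y =>
      G.continuousOn_inflow hfin S hv y) ⟨x, hx⟩).intervalIntegrable_of_Icc ht
  have hi2 : IntervalIntegrable (fun s => M * G.dirichletSemigroup hfin S (t - s)
      (fun y => G.inflow hfin S 1 y) ⟨x, hx⟩) volume 0 t :=
    (continuousOn_const.mul (G.continuousOn_dirichletSemigroup_apply hfin S t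
      continuousOn_const ⟨x, hx⟩)).intervalIntegrable_of_Icc ht
  rw [abs_of_nonneg]
  · refine intervalIntegral.integral_mono_on ht hi1 hi2 fun s hs => ?_
    have := G.dirichletSemigroup_mono hfin S (sub_nonneg.2 hs.2)
      (f := fun y => G.inflow hfin S (fun z => v z s) y)
      (g := M • fun y : S => G.inflow hfin S 1 y)
      (fun y => G.inflow_le hfin S (fun z => hM z s hs) y) ⟨x, hx⟩
    rwa [map_smul] at this
  · exact intervalIntegral.integral_nonneg ht fun s hs =>
      G.dirichletSemigroup_nonneg hfin S (sub_nonneg.2 hs.2)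
        (fun y => G.inflow_nonneg hfin S (fun z => h0 z s hs) y) ⟨x, hx⟩

/-- Duhamel's formula for bounded nonnegative solutions of the inhomogeneous heat equation with
bounded right-hand side on a stochastically complete graph. -/
theorem StochasticallyComplete.duhamel [Countable X] [Nonempty X]
    (hsc : G.StochasticallyComplete) (hfin : G.LocallyFinite)
    {v g : X → ℝ → ℝ} {t M N : ℝ} (ht : 0 < t) (hv : ∀ x, ContinuousOn (v x) (Icc 0 t))
    (hg : ∀ x, ContinuousOn (g x) (Icc 0 t))
    (hd : ∀ x, ∀ s ∈ Ioo 0 t, HasDerivAt (v x) (G.laplacian (fun z => v z s) x + g x s) s)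
    (h0 : ∀ x, ∀ s ∈ Icc 0 t, 0 ≤ v x s) (hM : ∀ x, ∀ s ∈ Icc 0 t, v x s ≤ M)
    (hN : ∀ x, ∀ s ∈ Icc 0 t, |g x s| ≤ N) (x : X) :
    IntervalIntegrable (fun s => G.heatSemigroup (t - s) (fun y => g y s) x) volume 0 t ∧
    v x t = G.heatSemigroup t (fun y => v y 0) x +
      ∫ s in (0 : ℝ)..t, G.heatSemigroup (t - s) (fun y => g y s) x := by
  have hmeas : ∀ S, AEStronglyMeasurable
      (fun s => ∑' y, G.dirichletKernel hfin S x y (t - s) * g y s * G.μ y)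
      (volume.restrict (Ioc 0 t)) := by
    intro S
    have he : (fun s => ∑' y, G.dirichletKernel hfin S x y (t - s) * g y s * G.μ y) =
        fun s => ∑ y ∈ S, G.dirichletKernel hfin S x y (t - s) * g y s * G.μ y :=
      funext fun s => tsum_eq_sum fun y hy => by
        rw [G.dirichletKernel_eq_zero hfin hy, zero_mul, zero_mul]
    rw [he]
    refine (ContinuousOn.mono ?_ Ioc_subset_Icc_self).aestronglyMeasurable measurableSet_Ioc
    exact continuousOn_finsetSum _ fun y _ => (((G.continuous_dirichletKernel hfin S x y).comp
      (continuous_const.sub continuous_id)).continuousOn.mul (hg y)).mul continuousOn_const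
  -- The endpoint `s = t` is discarded as a null set: stochastic completeness speaks only of
  -- positive times `t - s`.
  have hae : ∀ᵐ s ∂(volume.restrict (Ioc 0 t)), s ∈ Ioo 0 t := by
    rw [← restrict_Ioo_eq_restrict_Ioc]
    exact ae_restrict_mem measurableSet_Ioo
  have hlim : ∀ s ∈ Ioo 0 t,
      Tendsto (fun S => ∑' y, G.dirichletKernel hfin S x y (t - s) * g y s * G.μ y) atTop
        (𝓝 (G.heatSemigroup (t - s) (fun y => g y s) x)) := fun s hs =>
    tendsto_tsum_dirichletKernel hfin hsc (sub_pos.2 hs.2)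
      (fun y => hN y s (Ioo_subset_Icc_self hs)) x
  have hbound : ∀ S, ∀ s ∈ Ioo 0 t,
      ‖∑' y, G.dirichletKernel hfin S x y (t - s) * g y s * G.μ y‖ ≤ N := fun S s hs =>
    norm_tsum_dirichletKernel_le hfin hsc S (sub_pos.2 hs.2)
      (fun y => hN y s (Ioo_subset_Icc_self hs)) x
  refine ⟨(intervalIntegrable_iff_integrableOn_Ioc_of_le ht.le).2 (Integrable.mono'
    (integrable_const N)
    (aestronglyMeasurable_of_tendsto_ae atTop hmeas (hae.mono hlim))
    (hae.mono fun s hs => le_of_tendsto (hlim s hs).norm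
      (Eventually.of_forall fun S => hbound S s hs))), ?_⟩
  have hI : Tendsto (fun S => ∫ s in (0 : ℝ)..t,
      ∑' y, G.dirichletKernel hfin S x y (t - s) * g y s * G.μ y) atTop
      (𝓝 (∫ s in (0 : ℝ)..t, G.heatSemigroup (t - s) (fun y => g y s) x)) := by
    simp only [intervalIntegral.integral_of_le ht.le]
    exact tendsto_integral_filter_of_dominated_convergence (fun _ => N)
      (Eventually.of_forall hmeas) (Eventually.of_forall fun S => hae.mono (hbound S))
      (integrable_const N) (hae.mono hlim)
  have h0t : (0 : ℝ) ∈ Icc 0 t := left_mem_Icc.2 ht.le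
  have hU := (tendsto_tsum_dirichletKernel hfin hsc ht (φ := fun y => v y 0) (M := M)
    (fun y => by rw [abs_of_nonneg (h0 y 0 h0t)]; exact hM y 0 h0t) x).add hI
  have h1 := tendsto_tsum_dirichletKernel hfin hsc ht (φ := 1) (M := 1) (fun y => by simp) x
  rw [heatSemigroup_one hsc ht] at h1
  -- The truncation error is at most M(1 - P^S_t 1), which tends to M(1 - 1) = 0.
  have hR := (h1.const_sub 1).const_mul M
  rw [sub_self, mul_zero] at hR
  have hle := le_of_tendsto_of_tendsto (hU.const_sub (v x t)).abs hR (by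
    filter_upwards [eventually_ge_atTop ({x} : Finset X)] with S hS
    exact abs_sub_truncated_duhamel_le hfin S ht.le hv hg (fun x _ => hd x) h0 hM
      (hS (Finset.mem_singleton_self x)))
  exact sub_eq_zero.1 (abs_nonpos_iff.1 hle)

end WeightedGraph

end

/-! ### Classical solutions are mild solutions -/

theorem proposition3p7 {X : Type*} [Countable X] [Infinite X] (G : WeightedGraph X)
    (hconn : G.IsConnected) (hfin : G.LocallyFinite) (hsc : G.StochasticallyComplete)
    (p : ℝ) (hp : 1 < p)
    (u₀ : X → ℝ) (hu₀_nonneg : ∀ x, 0 ≤ u₀ x)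
    (hu₀_bdd : BddAbove (Set.range fun x => |u₀ x|))
    (u : X → ℝ → ℝ) (hu : G.IsGlobalClassicalSolution p u₀ u) :
    G.IsGlobalMildSolution p u₀ u := by
  have hp0 : 0 ≤ p := by linarith
  have hnonneg : ∀ x t, 0 ≤ t → 0 ≤ u x t := by
    intro x t ht
    rcases ht.eq_or_lt with rfl | ht
    · rw [hu.initial]; exact hu₀_nonneg x
    · exact hu.nonneg x t ht
  have key : ∀ x t, 0 < t →
      IntervalIntegrable (fun s => G.heatSemigroup (t - s) (fun y => u y s ^ p) x) volume 0 t ∧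
      u x t = G.heatSemigroup t u₀ x
        + ∫ s in (0 : ℝ)..t, G.heatSemigroup (t - s) (fun y => u y s ^ p) x := by
    intro x t ht
    obtain ⟨M, hM⟩ := hu.bounded t ht
    have hle : ∀ x, ∀ s ∈ Icc 0 t, u x s ≤ M := fun x s hs => (le_abs_self _).trans (hM x s hs)
    -- The nonlinearity is treated as a given source: `u` is already known, and 0 ≤ u ≤ M bounds u^p
    -- by M^p.
    have h := hsc.duhamel hfin (v := u) (g := fun y s => u y s ^ p) (M := M) (N := M ^ p) ht
      (fun x => hu.regular.continuousOn_Icc x t)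
      (fun x => (hu.regular.continuousOn_Icc x t).rpow_const fun _ _ => Or.inr hp0)
      (fun x s hs => (hu.regular.hasDerivAt x hs.1).congr_deriv
        (sub_eq_iff_eq_add'.1 (hu.equation x s hs.1)))
      (fun x s hs => hnonneg x s hs.1) hle
      (fun x s hs => by
        rw [abs_of_nonneg (Real.rpow_nonneg (hnonneg x s hs.1) p)]
        exact Real.rpow_le_rpow (hnonneg x s hs.1) (hle x s hs) hp0) x
    simpa only [hu.initial] using h
  intro τ hτ
  exact
    { nonneg := fun x t ht => hnonneg x t ht.1
      measurable := fun x =>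
        (hu.regular.continuousOn_Icc x τ).aestronglyMeasurable measurableSet_Icc
      bounded := hu.bounded τ hτ
      initial := hu.initial
      integrable := fun x t ht => (key x t ht.1).1
      duhamel := fun x t ht => (key x t ht.1).2 }
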